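/- **Proposition 3.1.** Let $\eta=(\eta(t))_{t\in\mathbb Z}$ be a simple max-stable process: a real-valued process with $\mathbb P[\eta(t)\le y]=\exp(-1/y)$ for all $t\in\mathbb Z$, $y>0$, such that $n^{-1}\bigvee_{i=1}^n\eta_i\stackrel{d}{=}\eta$ for all $n\ge 1$, where $\eta_1,\eta_2,\dots$ are independent copies of $\eta$ and $\bigvee$ denotes the pointwise maximum. Let $Y=(Y(t))_{t\in\mathbb Z}$ be a nonnegative process with $\mathbb E[Y(t)]=1$ for all $t\in\mathbb Z$ which is a spectral process of $\eta$, i.e. $$\big(\eta(t)\big)_{t\in\mathbb Z}\stackrel{d}{=}\Big(\bigvee_{i\ge 1}U_iY_i(t)\Big)_{t\in\mathbb Z},$$ where $(Y_i)_{i\ge1}$ are i.i.d. copies of $Y$ and $(U_i)_{i\ge 1}$ are the points of a Poisson point process on $(0,\infty)$ with intensity $u^{-2}\,du$, the sequence $(U_i)_{i\ge1}$ being independent of $(Y_i)_{i\ge1}$. For $t,t'\in\mathbb Z$ let $$\alpha_{t,t'}=\inf\big\{c>0:\ \mathbb P\big[Y(t')/Y(t)\le c\,\big|\,Y(t)>0\big]>0\big\}$$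 be the essential infimum of $Y(t')/Y(t)$ conditionally on $Y(t)>0$. If $\eta$ satisfies the Markov property, i.e. for all $s\le t$ the conditional law of $\eta(t)$ given $(\eta(r))_{r\le s}$ equals its conditional law given $\eta(s)$, then for all integers $t_1<t<t_2$, $$\mathbb P\big[Y(t_1)=\alpha_{t,t_1}Y(t)\,\big|\,Y(t)>0\big]=1\quad\text{or}\quad \mathbb P\big[Y(t_2)=\alpha_{t,t_2}Y(t)\,\big|\,Y(t)>0\big]=1.$$ -/

import Mathlib

open MeasureTheory ProbabilityTheory

/-- A real-valued process `η` indexed by `ℤ` on `(Ω, P)` is simple max-stable: it has `1`-Fréchet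
marginals, and the normalised pointwise maximum of `n + 1` independent copies of it has the law
of `η`. The joint law of the independent copies is the product of copies of the law of `η`. -/
structure IsSimpleMaxStable {Ω : Type*} [MeasurableSpace Ω] (P : Measure Ω)
    (η : ℤ → Ω → ℝ) : Prop where
  measurable : ∀ t, Measurable (η t)
  frechet : ∀ (t : ℤ) (y : ℝ), 0 < y →
    P {ω | η t ω ≤ y} = ENNReal.ofReal (Real.exp (-1 / y))
  maxStable : ∀ n : ℕ,
    (Measure.pi fun _ : Fin (n + 1) => P.map fun ω t => η t ω).map
        (fun (x : Fin (n + 1) → ℤ → ℝ) (t : ℤ) =>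
          ((n + 1 : ℕ) : ℝ)⁻¹ * Finset.univ.sup' Finset.univ_nonempty fun i => x i t) =
      P.map fun ω t => η t ω

/-- The number of indices `i` with `U i ω ∈ B`: the number of points in `B`. -/
noncomputable def pointCount {Ω : Type*} (U : ℕ → Ω → ℝ) (B : Set ℝ) (ω : Ω) : ℕ∞ :=
  Set.encard {i | U i ω ∈ B}

/-- The random points `U 0, U 1, …` form a Poisson point process with intensity measure `ν`:
the numbers of points in disjoint Borel sets are independent, and the number of points in `B`
has the Poisson law with mean `ν B` (and is almost surely infinite when `ν B = ∞`). -/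
structure IsPoissonPointProcess {Ω : Type*} [MeasurableSpace Ω] (ρ : Measure Ω)
    (U : ℕ → Ω → ℝ) (ν : Measure ℝ) : Prop where
  measurable : ∀ i, Measurable (U i)
  indep : ∀ (k : ℕ) (B : Fin k → Set ℝ), (∀ j, MeasurableSet (B j)) →
    Pairwise (fun i j => Disjoint (B i) (B j)) →
    iIndepFun (fun j => pointCount U (B j)) ρ
  count_of_lt_top : ∀ B : Set ℝ, MeasurableSet B → ν B < ⊤ → ∀ n : ℕ,
    ρ {ω | pointCount U B ω = n} = poissonMeasure (ν B).toNNReal {n}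
  count_of_eq_top : ∀ B : Set ℝ, MeasurableSet B → ν B = ⊤ →
    ∀ᵐ ω ∂ρ, pointCount U B ω = ⊤

/-- The measure `u⁻² du` on `(0, ∞)`, seen as a measure on `ℝ` (null outside `(0, ∞)`). -/
noncomputable def inverseSquareMeasure : Measure ℝ :=
  (volume.restrict (Set.Ioi 0)).withDensity fun u => ENNReal.ofReal ((u ^ 2)⁻¹)

/-- `Y`, a process on `(Ω', Q)`, is a spectral process of `η`, a process on `(Ω, P)`, as witnessed
by random variables on a third space `(Ω'', ρ)`: the points `U i` of a Poisson point process with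
intensity `u⁻² du` on `(0, ∞)`, and an independent sequence of i.i.d. copies `Yc i` of `Y`, with
`η` equal in law, as a process, to the pointwise supremum of `U i * Yc i`. The suprema
are taken in `EReal`, so that they need no boundedness. -/
structure IsSpectralRepresentation {Ω Ω' Ω'' : Type*} [MeasurableSpace Ω] [MeasurableSpace Ω']
    [MeasurableSpace Ω''] (P : Measure Ω) (η : ℤ → Ω → ℝ) (Q : Measure Ω') (Y : ℤ → Ω' → ℝ)
    (ρ : Measure Ω'') (U : ℕ → Ω'' → ℝ) (Yc : ℕ → ℤ → Ω'' → ℝ) : Prop where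
  measurable : ∀ t, Measurable (Y t)
  nonneg : ∀ t, ∀ᵐ ω ∂Q, 0 ≤ Y t ω
  integral_eq_one : ∀ t, ∫ ω, Y t ω ∂Q = 1
  measurable_copy : ∀ i t, Measurable (Yc i t)
  identDistrib_copy : ∀ i, IdentDistrib (fun ω t => Yc i t ω) (fun ω t => Y t ω) ρ Q
  iIndepFun_copy : iIndepFun (fun i ω t => Yc i t ω) ρ
  poisson : IsPoissonPointProcess ρ U inverseSquareMeasure
  indepFun : IndepFun (fun ω i => U i ω) (fun ω i t => Yc i t ω) ρ
  identDistrib : IdentDistrib (fun ω t => (η t ω : EReal))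
    (fun ω t => ⨆ i, ((U i ω * Yc i t ω : ℝ) : EReal)) P ρ

/-- The Markov property: for `s ≤ t`, the conditional law of `η t` given the past
`σ(η r, r ≤ s)` is its conditional law given `η s`. -/
def IsMarkovProcess {Ω : Type*} [MeasurableSpace Ω] (P : Measure Ω) (η : ℤ → Ω → ℝ) : Prop :=
  ∀ s t : ℤ, s ≤ t → ∀ B : Set ℝ, MeasurableSet B →
    P[(η t ⁻¹' B).indicator (fun _ => (1 : ℝ)) |
        ⨆ r : {r : ℤ // r ≤ s}, MeasurableSpace.comap (η r) inferInstance] =ᵐ[P]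
      P[(η t ⁻¹' B).indicator (fun _ => (1 : ℝ)) | MeasurableSpace.comap (η s) inferInstance]

/-- The essential infimum `α_{t,t'}` of `Y t' / Y t` conditionally on `Y t > 0`. -/
noncomputable def ratioEssInf {Ω' : Type*} [MeasurableSpace Ω'] (Q : Measure Ω')
    (Y : ℤ → Ω' → ℝ) (t t' : ℤ) : ℝ :=
  sInf {c : ℝ | 0 < c ∧ 0 < cond Q {ω | 0 < Y t ω} {ω | Y t' ω / Y t ω ≤ c}}

/-!
The proof compares two expressions for the conditional law of `(η t₁, η t₂)` given `η t`.

Since the `U i` form a Poisson process with intensity `u⁻² du`, its Laplace functional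
(`IsPoissonPointProcess.lintegral_iInf_prod`) gives, for weights `a₁, s, a₂ ≥ 0`,
`P (a₁ η t₁ ≤ 1, s η t ≤ 1, a₂ η t₂ ≤ 1) = exp (-E max (a₁ Y t₁, s Y t, a₂ Y t₂))`
(`IsSpectralRepresentation.measure_mul_le_one`). The exponent is convex in `s`, with right
derivative `E [Y t; a₁ Y t₁ ≤ s Y t, a₂ Y t₂ ≤ s Y t]`, and `(η t)⁻¹` is a standard exponential
variable. So the conditional probability of `{a₁ η t₁ ≤ 1, a₂ η t₂ ≤ 1}` given `(η t)⁻¹ = s` is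
`exp (s - E max (a₁ Y t₁, s Y t, a₂ Y t₂)) * E [Y t; a₁ Y t₁ ≤ s Y t, a₂ Y t₂ ≤ s Y t]`
(`condExp_indicator_ae_eq_condProb`). The Markov property says that this factorises into the two
expressions with `a₂ = 0` and `a₁ = 0`, for almost every `s`, hence for every `s` by right
continuity (`IsSpectralRepresentation.condProb_max_eq_mul`).

Put `aᵢ = s bᵢ`. The expectations over the events then no longer depend on `s`, while the exponents
are linear in `s`. If the factors do not vanish, the exponents therefore agree. Their difference is the
mean of the overlap of `(b₁ Y t₁ - Y t)⁺` and `(b₂ Y t₂ - Y t)⁺`, so the events `{Y t < b₁ Y t₁}` and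
`{Y t < b₂ Y t₂}` are disjoint up to a null set. They are also independent under the probability
measure with density `Y t`, so one of them is null (`meanOn_eq_zero_or_eq_one`). But if neither ratio
`Y tᵢ / Y t` were a.s. equal to its essential infimum, then for some `b₁` and `b₂` both events would
have probability strictly between `0` and `1` (`exists_meanOn_ne`).
-/

open scoped ENNReal
open Filter Topology

/-! ### The Laplace functional of a Poisson point process -/

lemma measurable_pointCount {Ω : Type*} [MeasurableSpace Ω] {U : ℕ → Ω → ℝ}
    (hU : ∀ i, Measurable (U i)) {B : Set ℝ} (hB : MeasurableSet B) :
    Measurable (pointCount U B) := by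
  refine measurable_encard.comp (measurable_set_iff.2 fun i => ?_)
  exact measurableSet_setOfPred.1 (hU i hB)

section Poisson

variable {Ω : Type*} [MeasurableSpace Ω] {ρ : Measure Ω} [IsProbabilityMeasure ρ]
  {U : ℕ → Ω → ℝ} {ν : Measure ℝ}

lemma IsPoissonPointProcess.ae_pointCount_ne_top (hU : IsPoissonPointProcess ρ U ν) {B : Set ℝ}
    (hB : MeasurableSet B) (hν : ν B < ⊤) : ∀ᵐ ω ∂ρ, pointCount U B ω ≠ ⊤ := by
  have hm := measurable_pointCount hU.measurable hB
  have h1 : ρ (⋃ n : ℕ, {ω | pointCount U B ω = n}) = 1 := by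
    rw [measure_iUnion]
    · simp_rw [hU.count_of_lt_top B hB hν]
      rw [← measure_iUnion (fun i j hij => Set.disjoint_singleton.2 hij)
        (fun _ => .of_discrete), Set.iUnion_of_singleton, measure_univ]
    · intro i j hij
      refine Set.disjoint_left.2 fun ω hi hj => hij ?_
      simp only [Set.mem_ofPred_eq] at hi hj
      exact_mod_cast hi.symm.trans hj
    · exact fun n => hm (.of_discrete : MeasurableSet {(n : ℕ∞)})
  have h2 : ∀ᵐ ω ∂ρ, ω ∈ ⋃ n : ℕ, {ω | pointCount U B ω = n} :=
    (prob_compl_eq_zero_iff (.iUnion fun n : ℕ =>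
      (hm (.of_discrete : MeasurableSet {(n : ℕ∞)}) :
        MeasurableSet {ω | pointCount U B ω = n}))).2 h1
  filter_upwards [h2] with ω hω
  obtain ⟨n, hn⟩ := Set.mem_iUnion.1 hω
  simp only [Set.mem_ofPred_eq] at hn
  simp [hn]

lemma lintegral_pow_poissonMeasure (r : NNReal) {c : ℝ} (hc : 0 ≤ c) :
    ∫⁻ n, ENNReal.ofReal c ^ n ∂(poissonMeasure r) =
      ENNReal.ofReal (Real.exp (-(r * (1 - c)))) := by
  have key : HasSum (fun n : ℕ => Real.exp (-r) * ((r : ℝ) * c) ^ n / n.factorial)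
      (Real.exp (-(r * (1 - c)))) := by
    have h := (NormedSpace.expSeries_div_hasSum_exp ((r : ℝ) * c)).mul_left (Real.exp (-r))
    rw [← Real.exp_eq_exp_ℝ, ← Real.exp_add] at h
    rw [show -((r : ℝ) * (1 - c)) = -r + r * c by ring]
    simpa only [mul_div_assoc] using h
  rw [lintegral_countable', ← key.tsum_eq, ENNReal.ofReal_tsum_of_nonneg _ key.summable]
  · refine tsum_congr fun n => ?_
    rw [poissonMeasure_singleton, ← ENNReal.ofReal_pow hc, ← ENNReal.ofReal_mul (by positivity)]
    congr 1
    rw [mul_pow]; ring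
  · intro n; positivity

lemma IsPoissonPointProcess.lintegral_pow_pointCount (hU : IsPoissonPointProcess ρ U ν)
    {B : Set ℝ} (hB : MeasurableSet B) (hν : ν B < ⊤) {c : ℝ} (hc : 0 ≤ c) :
    ∫⁻ ω, ENNReal.ofReal c ^ (pointCount U B ω).toNat ∂ρ =
      ENNReal.ofReal (Real.exp (-((ν B).toReal * (1 - c)))) := by
  have hm : Measurable fun ω => (pointCount U B ω).toNat :=
    Measurable.of_discrete.comp (measurable_pointCount hU.measurable hB)
  have hlaw : ρ.map (fun ω => (pointCount U B ω).toNat) = poissonMeasure (ν B).toNNReal := by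
    refine Measure.ext_of_singleton fun n => ?_
    rw [Measure.map_apply hm (.singleton _), ← hU.count_of_lt_top B hB hν n]
    refine measure_congr ?_
    filter_upwards [hU.ae_pointCount_ne_top hB hν] with ω hω
    refine propext ?_
    change (pointCount U B ω).toNat = n ↔ pointCount U B ω = n
    constructor
    · rintro rfl; exact (ENat.natCast_toNat hω).symm
    · intro h; simp [h]
  have := lintegral_pow_poissonMeasure (ν B).toNNReal hc
  rw [← hlaw, lintegral_map .of_discrete hm] at this
  exact this

/-- For a sequence with finitely many factors different from `1`, all factors being at most `1`,
the infimum of the partial products is the finite product of those factors. -/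
lemma iInf_prod_range_eq_prod {x : ℕ → ℝ≥0∞} (hx : ∀ i, x i ≤ 1) (T : Finset ℕ)
    (hT : ∀ i, i ∉ T → x i = 1) : ⨅ N, ∏ i ∈ Finset.range N, x i = ∏ i ∈ T, x i := by
  refine le_antisymm ?_ (le_iInf fun N => ?_)
  · obtain ⟨N, hN⟩ := T.exists_nat_subset_range
    refine (iInf_le _ N).trans_eq (Finset.prod_subset hN fun i _ hi => hT i hi).symm
  · calc ∏ i ∈ T, x i ≤ ∏ i ∈ T ∩ Finset.range N, x i :=
          Finset.prod_le_prod_of_subset_of_le_one' Finset.inter_subset_left fun i _ _ => hx i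
      _ = ∏ i ∈ Finset.range N, x i :=
          Finset.prod_subset Finset.inter_subset_right fun i hi hi' => hT i fun h =>
            hi' (Finset.mem_inter.2 ⟨h, hi⟩)

/-- The Laplace functional for a simple function: a product over the levels `c` of independent
factors `(1 - c) ^ N`, with `N` the Poisson number of points at which the level is taken. -/
lemma IsPoissonPointProcess.lintegral_iInf_prod_simpleFunc (hU : IsPoissonPointProcess ρ U ν)
    (h : SimpleFunc ℝ ℝ≥0∞) (h1 : ∀ u, h u ≤ 1) (hfin : h.lintegral ν ≠ ⊤) :
    ∫⁻ ω, ⨅ N, ∏ i ∈ Finset.range N, (1 - h (U i ω)) ∂ρ =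
      ENNReal.ofReal (Real.exp (-(h.lintegral ν).toReal)) := by
  classical
  set C := h.range.filter (· ≠ 0) with hC
  have hC1 : ∀ c ∈ C, c ≤ 1 := by
    intro c hc
    obtain ⟨u, rfl⟩ := SimpleFunc.mem_range.1 (Finset.mem_filter.1 hc).1
    exact h1 u
  have hsupp : ν (Function.support h) < ⊤ :=
    SimpleFunc.measure_support_lt_top_of_lintegral_ne_top hfin
  have hB : ∀ c, MeasurableSet (h ⁻¹' {c}) := fun c => h.measurableSet_preimage _
  have hBfin : ∀ c ∈ C, ν (h ⁻¹' {c}) < ⊤ := by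
    intro c hc
    refine (measure_mono ?_).trans_lt hsupp
    intro u hu
    have : h u = c := hu
    simpa [this] using (Finset.mem_filter.1 hc).2
  -- the counts at the different levels are independent
  have hind : iIndepFun (fun (c : C) ω => (ENNReal.ofReal (1 - c.1.toReal)) ^
      (pointCount U (h ⁻¹' {c.1}) ω).toNat) ρ := by
    have e := C.equivFin
    have := hU.indep C.card (fun j => h ⁻¹' {(e.symm j).1}) (fun j => hB _) (by
      intro i j hij
      refine Set.disjoint_left.2 fun u hi hj => hij ?_
      have hi' : h u = _ := hi
      have hj' : h u = _ := hj
      exact e.symm.injective (Subtype.ext (hi'.symm.trans hj')))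
    have h2 := this.precomp e.injective
    have h3 := h2.comp (fun (c : C) (n : ℕ∞) => (ENNReal.ofReal (1 - c.1.toReal)) ^ n.toNat)
      (fun _ => .of_discrete)
    simpa [Function.comp_def] using h3
  have hlint := lintegral_prod_eq_prod_lintegral_of_indepFun (μ := ρ) Finset.univ _ hind
    (fun c => (Measurable.of_discrete (f := fun n : ℕ∞ =>
      (ENNReal.ofReal (1 - c.1.toReal)) ^ n.toNat)).comp
        (measurable_pointCount hU.measurable (hB c.1)))
  have hprod : ∀ᵐ ω ∂ρ, ⨅ N, ∏ i ∈ Finset.range N, (1 - h (U i ω)) =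
      ∏ c : C, (ENNReal.ofReal (1 - c.1.toReal)) ^ (pointCount U (h ⁻¹' {c.1}) ω).toNat := by
    filter_upwards [hU.ae_pointCount_ne_top (SimpleFunc.measurableSet_support h) hsupp] with ω hω
    have hTfin : {i | U i ω ∈ Function.support h}.Finite := Set.encard_ne_top_iff.1 hω
    set T := hTfin.toFinset with hT
    have memT : ∀ i, i ∈ T ↔ h (U i ω) ≠ 0 := by simp [hT]
    rw [iInf_prod_range_eq_prod (fun i => tsub_le_self) T (fun i hi => by
        rw [memT, not_not] at hi; simp [hi]),
      ← Finset.prod_fiberwise_of_maps_to (s := T) (t := C) (g := fun i => h (U i ω))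
        (fun i hi => Finset.mem_filter.2 ⟨SimpleFunc.mem_range_self _ _, (memT i).1 hi⟩),
      ← Finset.prod_coe_sort]
    refine Finset.prod_congr rfl fun c _ => ?_
    have hcard : (pointCount U (h ⁻¹' {c.1}) ω).toNat =
        (T.filter fun i => h (U i ω) = c.1).card := by
      have : {i | U i ω ∈ h ⁻¹' {c.1}} = (T.filter fun i => h (U i ω) = c.1 : Finset ℕ) := by
        ext i
        simp only [Set.mem_preimage, Set.mem_singleton_iff, Set.mem_ofPred_eq, Finset.coe_filter,
          memT]
        refine ⟨fun hi => ⟨?_, hi⟩, fun hi => hi.2⟩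
        rw [hi]; exact (Finset.mem_filter.1 c.2).2
      rw [pointCount, this, Set.encard_coe_eq_coe_finsetCard, ENat.toNat_natCast]
    rw [hcard, ← Finset.prod_const]
    refine Finset.prod_congr rfl fun i hi => ?_
    have hc1 := hC1 c.1 c.2
    rw [(Finset.mem_filter.1 hi).2, ENNReal.ofReal_sub _ ENNReal.toReal_nonneg,
      ENNReal.ofReal_toReal (hc1.trans_lt ENNReal.one_lt_top).ne, ENNReal.ofReal_one]
  rw [lintegral_congr_ae hprod, hlint]
  have hterm : ∀ c : C, ∫⁻ ω, (ENNReal.ofReal (1 - c.1.toReal)) ^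
      (pointCount U (h ⁻¹' {c.1}) ω).toNat ∂ρ =
      ENNReal.ofReal (Real.exp (-(c.1 * ν (h ⁻¹' {c.1})).toReal)) := by
    intro c
    have hc1 : c.1.toReal ≤ 1 := ENNReal.toReal_mono ENNReal.one_ne_top (hC1 c.1 c.2)
    rw [hU.lintegral_pow_pointCount (hB c.1) (hBfin c.1 c.2) (by linarith)]
    congr 3
    rw [ENNReal.toReal_mul]; ring
  have hsum : h.lintegral ν = ∑ c : C, c.1 * ν (h ⁻¹' {c.1}) := by
    rw [SimpleFunc.lintegral, Finset.sum_coe_sort C (fun c => c * ν (h ⁻¹' {c})), hC,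
      Finset.sum_filter_of_ne]
    intro c _ hc hc0
    simp [hc0] at hc
  rw [Finset.prod_congr rfl fun c _ => hterm c, ← ENNReal.ofReal_prod_of_nonneg
    fun _ _ => (Real.exp_pos _).le, ← Real.exp_sum, hsum, ENNReal.toReal_sum,
    Finset.sum_neg_distrib]
  intro c _
  exact ENNReal.mul_ne_top ((hC1 c.1 c.2).trans_lt ENNReal.one_lt_top).ne (hBfin c.1 c.2).ne

/-- The Laplace functional of a Poisson point process, with `1 - h` in place of `exp (-f)`. The
infinite product over the points, all of whose factors are at most `1`, is written as the infimum of
its partial products. -/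
theorem IsPoissonPointProcess.lintegral_iInf_prod (hU : IsPoissonPointProcess ρ U ν)
    {h : ℝ → ℝ≥0∞} (hm : Measurable h) (h1 : ∀ u, h u ≤ 1) (hfin : ∫⁻ u, h u ∂ν ≠ ⊤) :
    ∫⁻ ω, ⨅ N, ∏ i ∈ Finset.range N, (1 - h (U i ω)) ∂ρ =
      ENNReal.ofReal (Real.exp (-(∫⁻ u, h u ∂ν).toReal)) := by
  set φ := SimpleFunc.eapprox h
  have hmono : ∀ u, Monotone fun n => φ n u := fun u n m hnm => SimpleFunc.monotone_eapprox h hnm u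
  have hsup : ∀ u, ⨆ n, φ n u = h u := SimpleFunc.iSup_eapprox_apply hm
  have hle : ∀ n u, φ n u ≤ h u := fun n u => (le_iSup (fun n => φ n u) n).trans_eq (hsup u)
  have hlint : ∀ n, (φ n).lintegral ν ≤ ∫⁻ u, h u ∂ν := fun n => by
    rw [← SimpleFunc.lintegral_eq_lintegral]; exact lintegral_mono (hle n)
  -- the infinite product commutes with the monotone limit
  have hcomm : ∀ ω, ⨅ N, ∏ i ∈ Finset.range N, (1 - h (U i ω)) =
      ⨅ n, ⨅ N, ∏ i ∈ Finset.range N, (1 - φ n (U i ω)) := by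
    intro ω
    rw [iInf_comm]
    refine iInf_congr fun N => ?_
    have hanti : Antitone fun n => ∏ i ∈ Finset.range N, (1 - φ n (U i ω)) := fun n m hnm =>
      Finset.prod_le_prod' fun i _ => tsub_le_tsub_left (hmono _ hnm) _
    refine tendsto_nhds_unique ?_ (tendsto_atTop_iInf hanti)
    refine ENNReal.tendsto_finsetProd_of_ne_top _ (fun i _ => ?_) (fun i _ => ?_)
    · refine ENNReal.Tendsto.sub tendsto_const_nhds ?_ (Or.inl ENNReal.one_ne_top)
      rw [← hsup]
      exact tendsto_atTop_iSup (hmono _)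
    · exact (tsub_le_self.trans_lt ENNReal.one_lt_top).ne
  simp_rw [hcomm]
  have hmeas : ∀ n, Measurable fun ω => ⨅ N, ∏ i ∈ Finset.range N, (1 - φ n (U i ω)) := fun n =>
    Measurable.iInf fun N => Finset.measurable_prod _ fun i _ =>
      measurable_const.sub ((φ n).measurable.comp (hU.measurable i))
  have hanti : Antitone fun n ω => ⨅ N, ∏ i ∈ Finset.range N, (1 - φ n (U i ω)) := fun n m hnm ω =>
    iInf_mono fun N => Finset.prod_le_prod' fun i _ => tsub_le_tsub_left (hmono _ hnm) _
  have hval := fun n => hU.lintegral_iInf_prod_simpleFunc (φ n) (fun u => (hle n u).trans (h1 u))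
    ((hlint n).trans_lt hfin.lt_top).ne
  rw [lintegral_iInf hmeas hanti (by rw [hval]; exact ENNReal.ofReal_ne_top)]
  have hanti' : Antitone fun n => ∫⁻ ω, ⨅ N, ∏ i ∈ Finset.range N, (1 - φ n (U i ω)) ∂ρ :=
    fun n m hnm => lintegral_mono (hanti hnm)
  refine tendsto_nhds_unique (tendsto_atTop_iInf hanti') ?_
  simp_rw [hval]
  refine (ENNReal.continuous_ofReal.tendsto _).comp ((Real.continuous_exp.tendsto _).comp
    (Tendsto.neg ((ENNReal.tendsto_toReal hfin).comp ?_)))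
  have : Tendsto (fun n => ∫⁻ u, φ n u ∂ν) atTop (𝓝 (∫⁻ u, h u ∂ν)) := by
    rw [lintegral_congr fun u => (hsup u).symm, lintegral_iSup (fun n => (φ n).measurable)
      (fun n m hnm u => hmono u hnm)]
    exact tendsto_atTop_iSup fun n m hnm => lintegral_mono fun u => hmono u hnm
  simpa only [SimpleFunc.lintegral_eq_lintegral] using this

end Poisson

/-! ### Finite-dimensional distributions from a spectral process -/

lemma inverseSquareMeasure_setOf_one_lt_mul {m : ℝ} (hm : 0 ≤ m) :
    inverseSquareMeasure {u | 1 < u * m} = ENNReal.ofReal m := by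
  rcases hm.eq_or_lt with rfl | hm
  · simp [not_lt.2 zero_le_one]
  have hset : {u : ℝ | 1 < u * m} = Set.Ioi m⁻¹ := by
    ext u
    simp only [Set.mem_ofPred_eq, Set.mem_Ioi]
    rw [inv_lt_iff_one_lt_mul₀ hm]
  have hrpow : ∀ u ∈ Set.Ioi m⁻¹, ENNReal.ofReal ((u ^ 2)⁻¹) = ENNReal.ofReal (u ^ (-2 : ℝ)) := by
    intro u hu
    have : 0 < u := (inv_pos.2 hm).trans hu
    rw [Real.rpow_neg this.le, Real.rpow_two]
  rw [hset, inverseSquareMeasure, withDensity_apply _ measurableSet_Ioi,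
    Measure.restrict_restrict measurableSet_Ioi,
    Set.inter_eq_left.2 (Set.Ioi_subset_Ioi (inv_pos.2 hm).le),
    setLIntegral_congr_fun measurableSet_Ioi hrpow,
    ← ofReal_integral_eq_lintegral_ofReal
      (integrableOn_Ioi_rpow_of_lt (by norm_num) (inv_pos.2 hm)),
    integral_Ioi_rpow_of_lt (by norm_num) (inv_pos.2 hm)]
  · congr 1
    norm_num
    rw [Real.rpow_neg_one, inv_inv]
  · filter_upwards [ae_restrict_mem measurableSet_Ioi] with u hu
    exact Real.rpow_nonneg ((inv_pos.2 hm).trans hu).le _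

lemma IsPoissonPointProcess.ae_pos {Ω : Type*} [MeasurableSpace Ω] {ρ : Measure Ω}
    [IsProbabilityMeasure ρ] {U : ℕ → Ω → ℝ}
    (hU : IsPoissonPointProcess ρ U inverseSquareMeasure) : ∀ᵐ ω ∂ρ, ∀ i, 0 < U i ω := by
  have hν : inverseSquareMeasure (Set.Iic 0) = 0 := by
    refine withDensity_absolutelyContinuous _ _ ?_
    rw [Measure.restrict_apply measurableSet_Iic, Set.Iic_inter_Ioi, Set.Ioc_self, measure_empty]
  have h0 := hU.count_of_lt_top (Set.Iic 0) measurableSet_Iic (by simp [hν]) 0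
  rw [hν, poissonMeasure_singleton] at h0
  have hm : MeasurableSet {ω | pointCount U (Set.Iic 0) ω = ((0 : ℕ) : ℕ∞)} :=
    measurable_pointCount hU.measurable measurableSet_Iic
      (.of_discrete : MeasurableSet {((0 : ℕ) : ℕ∞)})
  have h1 : ∀ᵐ ω ∂ρ, ω ∈ {ω | pointCount U (Set.Iic 0) ω = ((0 : ℕ) : ℕ∞)} :=
    (prob_compl_eq_zero_iff hm).2 (by simpa using h0)
  filter_upwards [h1] with ω hω i
  have : {i | U i ω ∈ Set.Iic (0 : ℝ)} = ∅ := by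
    rw [← Set.encard_eq_zero]; exact_mod_cast hω
  by_contra hi
  have : i ∈ (∅ : Set ℕ) := this ▸ (not_lt.1 hi : U i ω ≤ 0)
  exact this

/-- If `M 0, M 1, …` are i.i.d. nonnegative marks with law `μ`, independent of a Poisson point
process `U` with intensity `u⁻² du`, then `sup (U i * M i)` is Fréchet with scale the mean
of `μ`. -/
theorem IsPoissonPointProcess.measure_forall_mul_le_one {Ω : Type*} [MeasurableSpace Ω]
    {ρ : Measure Ω} [IsProbabilityMeasure ρ] {U M : ℕ → Ω → ℝ} {μ : Measure ℝ}
    [IsProbabilityMeasure μ] (hU : IsPoissonPointProcess ρ U inverseSquareMeasure)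
    (hM : ∀ i, Measurable (M i)) (hlaw : ∀ i, ρ.map (M i) = μ) (hind : iIndepFun M ρ)
    (hUM : IndepFun (fun ω i => U i ω) (fun ω i => M i ω) ρ)
    (hint : Integrable (fun m => m) μ) (h0 : ∀ᵐ m ∂μ, 0 ≤ m) :
    ρ {ω | ∀ i, U i ω * M i ω ≤ 1} = ENNReal.ofReal (Real.exp (-∫ m, m ∂μ)) := by
  have hUm : Measurable fun ω i => U i ω := measurable_pi_lambda _ hU.measurable
  have hMm : Measurable fun ω i => M i ω := measurable_pi_lambda _ hM
  have hmul : MeasurableSet {p : ℝ × ℝ | 1 < p.1 * p.2} :=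
    measurableSet_lt measurable_const (measurable_fst.mul measurable_snd)
  set h : ℝ → ℝ≥0∞ := fun u => μ {m | 1 < u * m} with hh
  have hhm : Measurable h := measurable_measure_prodMk_left hmul
  have hlint : ∫⁻ u, h u ∂inverseSquareMeasure = ∫⁻ m, ENNReal.ofReal m ∂μ := by
    have : SFinite inverseSquareMeasure := by unfold inverseSquareMeasure; infer_instance
    have e1 := Measure.prod_apply (μ := inverseSquareMeasure) (ν := μ) hmul
    have e2 := Measure.prod_apply_symm (μ := inverseSquareMeasure) (ν := μ) hmul
    refine (e1.symm.trans e2).trans (lintegral_congr_ae ?_)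
    filter_upwards [h0] with m hm
    exact inverseSquareMeasure_setOf_one_lt_mul hm
  -- conditionally on the points, the marks give an infinite product
  have hcond : ∀ u : ℕ → ℝ, ρ {ω | ∀ i, u i * M i ω ≤ 1} =
      ⨅ N, ∏ i ∈ Finset.range N, (1 - h (u i)) := by
    intro u
    have hS : ∀ i, MeasurableSet {m : ℝ | u i * m ≤ 1} := fun i =>
      measurableSet_le (measurable_const.mul measurable_id) measurable_const
    have hset : {ω | ∀ i, u i * M i ω ≤ 1} =
        ⋂ N, ⋂ i ∈ Finset.range N, M i ⁻¹' {m | u i * m ≤ 1} := by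
      ext ω
      simp only [Set.mem_ofPred_eq, Set.mem_iInter, Set.mem_preimage, Finset.mem_range]
      exact ⟨fun H N i _ => H i, fun H i => H (i + 1) i (Nat.lt_succ_self i)⟩
    rw [hset, Antitone.measure_iInter]
    · refine iInf_congr fun N => ?_
      rw [hind.measure_inter_preimage_eq_mul _ fun i _ => hS i]
      refine Finset.prod_congr rfl fun i _ => ?_
      rw [← Measure.map_apply (hM i) (hS i), hlaw i, hh]
      have : {m : ℝ | u i * m ≤ 1} = {m | 1 < u i * m}ᶜ := by ext m; simp
      rw [this, prob_compl_eq_one_sub]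
      exact measurableSet_lt measurable_const (measurable_const.mul measurable_id)
    · intro N N' hN
      exact Set.biInter_subset_biInter_left fun i hi =>
        Finset.mem_range.2 ((Finset.mem_range.1 hi).trans_le hN)
    · exact fun N => (Finset.measurableSet_biInter _ fun i _ => hM i (hS i)).nullMeasurableSet
    · exact ⟨0, measure_ne_top _ _⟩
  have hS : MeasurableSet {p : (ℕ → ℝ) × (ℕ → ℝ) | ∀ i, p.1 i * p.2 i ≤ 1} := by
    rw [Set.ofPred_forall]
    refine MeasurableSet.iInter fun i => measurableSet_le ?_ measurable_const
    exact ((measurable_pi_apply i).comp measurable_fst).mul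
      ((measurable_pi_apply i).comp measurable_snd)
  -- integrate over the points, which are independent of the marks
  have hfub : ρ {ω | ∀ i, U i ω * M i ω ≤ 1} =
      ∫⁻ ω, ⨅ N, ∏ i ∈ Finset.range N, (1 - h (U i ω)) ∂ρ := by
    have e1 := (indepFun_iff_map_prod_eq_prod_map_map hUm.aemeasurable hMm.aemeasurable).1 hUM
    have e2 := congrArg (fun κ => κ {p : (ℕ → ℝ) × (ℕ → ℝ) | ∀ i, p.1 i * p.2 i ≤ 1}) e1
    beta_reduce at e2
    have : IsProbabilityMeasure (ρ.map fun ω i => M i ω) :=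
      Measure.isProbabilityMeasure_map hMm.aemeasurable
    rw [Measure.map_apply (hUm.prodMk hMm) hS, Measure.prod_apply hS,
      lintegral_map (measurable_measure_prodMk_left hS) hUm] at e2
    refine e2.trans (lintegral_congr fun ω => ?_)
    rw [Measure.map_apply hMm (measurable_prodMk_left hS)]
    exact hcond fun i => U i ω
  have hfin : ∫⁻ u, h u ∂inverseSquareMeasure ≠ ⊤ := by
    rw [hlint]; exact hint.lintegral_lt_top.ne
  rw [hfub, hU.lintegral_iInf_prod hhm (fun u => prob_le_one) hfin, hlint,
    integral_eq_lintegral_of_nonneg_ae h0 hint.1]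

section Spectral

variable {Ω Ω' Ω'' : Type*} [MeasurableSpace Ω] [MeasurableSpace Ω'] [MeasurableSpace Ω'']
  {P : Measure Ω} [IsProbabilityMeasure P] {Q : Measure Ω'} [IsProbabilityMeasure Q]
  {ρ : Measure Ω''} [IsProbabilityMeasure ρ] {η : ℤ → Ω → ℝ} {Y : ℤ → Ω' → ℝ} {U : ℕ → Ω'' → ℝ}
  {Yc : ℕ → ℤ → Ω'' → ℝ}

omit [IsProbabilityMeasure P] [IsProbabilityMeasure Q] [IsProbabilityMeasure ρ] in
lemma IsSpectralRepresentation.integrable (hY : IsSpectralRepresentation P η Q Y ρ U Yc) (t : ℤ) :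
    Integrable (Y t) Q := by
  by_contra h
  -- the integral of a non-integrable function is `0`, not `1`
  have := hY.integral_eq_one t
  rw [integral_undef h] at this
  exact zero_ne_one this

omit [IsProbabilityMeasure P] in
/-- The trivariate distribution function of a process with spectral process `Y`. The levels are
given by their reciprocals, so that a weight `0` removes a constraint. -/
theorem IsSpectralRepresentation.measure_mul_le_one
    (hY : IsSpectralRepresentation P η Q Y ρ U Yc) (t₁ t t₂ : ℤ) {a₁ s a₂ : ℝ} (h₁ : 0 ≤ a₁)
    (hs : 0 ≤ s) (h₂ : 0 ≤ a₂) :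
    P {ω | a₁ * η t₁ ω ≤ 1 ∧ s * η t ω ≤ 1 ∧ a₂ * η t₂ ω ≤ 1} =
      ENNReal.ofReal (Real.exp (-∫ ω, max (a₁ * Y t₁ ω) (max (s * Y t ω) (a₂ * Y t₂ ω)) ∂Q)) := by
  -- the constraint `a * x ≤ 1` as an upper bound for `x`, which is `⊤` when `a = 0`
  set b : ℝ → EReal := fun a => if 0 < a then ((1 / a : ℝ) : EReal) else ⊤ with hb
  have hbiff : ∀ a x : ℝ, 0 ≤ a → ((x : EReal) ≤ b a ↔ a * x ≤ 1) := by
    intro a x ha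
    rcases ha.eq_or_lt with rfl | ha
    · simp [hb]
    · simp only [hb, ha, if_true, EReal.coe_le_coe_iff]
      rw [le_div_iff₀ ha, mul_comm]
  set S : Set (ℤ → EReal) := {x | x t₁ ≤ b a₁ ∧ x t ≤ b s ∧ x t₂ ≤ b a₂} with hS
  have hSm : MeasurableSet S :=
    (measurableSet_le (measurable_pi_apply _) measurable_const).inter
      ((measurableSet_le (measurable_pi_apply _) measurable_const).inter
        (measurableSet_le (measurable_pi_apply _) measurable_const))
  set W : (ℤ → ℝ) → ℝ := fun y => max (a₁ * y t₁) (max (s * y t) (a₂ * y t₂)) with hW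
  have hWm : Measurable W := by fun_prop
  have hYm : Measurable fun ω t => Y t ω := measurable_pi_lambda _ hY.measurable
  have hWYm : Measurable fun ω => W fun t => Y t ω := hWm.comp hYm
  have : IsProbabilityMeasure (Q.map fun ω => W fun t => Y t ω) :=
    Measure.isProbabilityMeasure_map hWYm.aemeasurable
  have hint : Integrable (fun ω => W fun t => Y t ω) Q :=
    ((hY.integrable t₁).const_mul a₁).sup
      (((hY.integrable t).const_mul s).sup ((hY.integrable t₂).const_mul a₂))
  have key := hY.poisson.measure_forall_mul_le_one (M := fun i ω => W fun t => Yc i t ω)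
    (μ := Q.map fun ω => W fun t => Y t ω)
    (fun i => hWm.comp (measurable_pi_lambda _ (hY.measurable_copy i)))
    (fun i => ((hY.identDistrib_copy i).comp hWm).map_eq)
    (hY.iIndepFun_copy.comp (fun _ => W) fun _ => hWm)
    (hY.indepFun.comp (φ := fun x => x) (ψ := fun (y : ℕ → ℤ → ℝ) i => W (y i)) measurable_id
      (measurable_pi_lambda _ fun i => hWm.comp (measurable_pi_apply i)))
    ((integrable_map_measure measurable_id.aestronglyMeasurable hWYm.aemeasurable).2 hint)
    (by
      rw [ae_map_iff hWYm.aemeasurable measurableSet_Ici]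
      filter_upwards [hY.nonneg t] with ω hω
      exact le_max_of_le_right (le_max_of_le_left (mul_nonneg hs hω)))
  rw [integral_map (f := fun m : ℝ => m) hWYm.aemeasurable
    measurable_id.aestronglyMeasurable] at key
  rw [← key]
  have e : P {ω | a₁ * η t₁ ω ≤ 1 ∧ s * η t ω ≤ 1 ∧ a₂ * η t₂ ω ≤ 1} =
      P ((fun ω t => (η t ω : EReal)) ⁻¹' S) := by
    congr 1
    ext ω
    simp [hS, hbiff, h₁, hs, h₂]
  rw [e, hY.identDistrib.measure_mem_eq hSm]
  refine measure_congr ?_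
  filter_upwards [hY.poisson.ae_pos] with ω hω
  refine propext ?_
  change ((⨆ i, ((U i ω * Yc i t₁ ω : ℝ) : EReal)) ≤ b a₁ ∧ (⨆ i, ((U i ω * Yc i t ω : ℝ) : EReal))
    ≤ b s ∧ (⨆ i, ((U i ω * Yc i t₂ ω : ℝ) : EReal)) ≤ b a₂) ↔
    ∀ i, U i ω * max (a₁ * Yc i t₁ ω) (max (s * Yc i t ω) (a₂ * Yc i t₂ ω)) ≤ 1
  simp only [iSup_le_iff, hbiff _ _ h₁, hbiff _ _ hs, hbiff _ _ h₂, mul_max_of_nonneg _ _ (hω _).le,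
    max_le_iff, forall_and, mul_left_comm]

end Spectral

/-! ### The exponent function and its right derivative -/

section Exponent

variable {Ω : Type*} [MeasurableSpace Ω]

/-- The mean of `max (s * X) m`, as a function of `s`. -/
noncomputable def meanMax (Q : Measure Ω) (X m : Ω → ℝ) (s : ℝ) : ℝ :=
  ∫ ω, max (s * X ω) (m ω) ∂Q

/-- The mean of `X` on the event `m ≤ s * X`: the right derivative of `meanMax` at `s`. -/
noncomputable def meanOn (Q : Measure Ω) (X m : Ω → ℝ) (s : ℝ) : ℝ :=
  ∫ ω, {ω | m ω ≤ s * X ω}.indicator X ω ∂Q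

variable {Q : Measure Ω} {X m : Ω → ℝ}

lemma measurableSet_le_const_mul (hX : Measurable X) (hm : Measurable m) (s : ℝ) :
    MeasurableSet {ω | m ω ≤ s * X ω} :=
  measurableSet_le hm (measurable_const.mul hX)

lemma hasDerivWithinAt_meanMax (hXi : Integrable X Q)
    (hmi : Integrable m Q) (hX0 : ∀ᵐ ω ∂Q, 0 ≤ X ω) (s : ℝ) :
    HasDerivWithinAt (meanMax Q X m) (meanOn Q X m s) (Set.Ioi s) s := by
  rw [hasDerivWithinAt_iff_tendsto_slope' (Set.self_notMem_Ioi)]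
  have hi : ∀ r, Integrable (fun ω => max (r * X ω) (m ω)) Q := fun r => (hXi.const_mul r).sup hmi
  have hslope : ∀ r, slope (meanMax Q X m) s r =
      ∫ ω, (r - s)⁻¹ * (max (r * X ω) (m ω) - max (s * X ω) (m ω)) ∂Q := by
    intro r
    rw [slope_def_module, integral_const_mul, integral_sub (hi r) (hi s), smul_eq_mul]; rfl
  simp_rw [funext hslope]
  refine tendsto_integral_filter_of_dominated_convergence X ?_ ?_ hXi ?_
  · exact Eventually.of_forall fun r => (((hi r).sub (hi s)).const_mul _).1
  · filter_upwards [self_mem_nhdsWithin] with r hr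
    filter_upwards [hX0] with ω hω
    have hr : 0 < r - s := sub_pos.2 hr
    rw [Real.norm_eq_abs, abs_mul, abs_of_pos (inv_pos.2 hr), inv_mul_le_iff₀ hr]
    refine (abs_max_sub_max_le_abs _ _ _).trans_eq ?_
    rw [← sub_mul, abs_mul, abs_of_pos hr, abs_of_nonneg hω]
  · filter_upwards [hX0] with ω hω
    by_cases h : m ω ≤ s * X ω
    · refine tendsto_const_nhds.congr' ?_
      filter_upwards [self_mem_nhdsWithin] with r hr
      have hr' : 0 < r - s := sub_pos.2 hr
      have : s * X ω ≤ r * X ω := mul_le_mul_of_nonneg_right (le_of_lt hr) hω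
      rw [Set.indicator_of_mem (by exact h), max_eq_left h, max_eq_left (h.trans this)]
      field_simp
    · rw [Set.indicator_of_notMem (by exact h)]
      refine tendsto_const_nhds.congr' ?_
      have hc : Tendsto (fun r => r * X ω) (𝓝[>] s) (𝓝 (s * X ω)) :=
        ((continuous_mul_const (X ω)).tendsto s).mono_left nhdsWithin_le_nhds
      filter_upwards [hc.eventually_lt_const (not_le.1 h)] with r hr
      rw [max_eq_right hr.le, max_eq_right (not_le.1 h).le]; simp

/-- `meanOn` is right continuous, because for `0 ≤ X ω` the set `{s | m ω ≤ s * X ω}` is closed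
and upward closed. -/
lemma tendsto_meanOn (hX : Measurable X) (hm : Measurable m) (hXi : Integrable X Q)
    (hX0 : ∀ᵐ ω ∂Q, 0 ≤ X ω) (s : ℝ) :
    Tendsto (meanOn Q X m) (𝓝[>] s) (𝓝 (meanOn Q X m s)) := by
  refine tendsto_integral_filter_of_dominated_convergence (fun ω => ‖X ω‖) ?_ ?_ hXi.norm ?_
  · exact Eventually.of_forall fun r => (hXi.indicator (measurableSet_le_const_mul hX hm r)).1
  · exact Eventually.of_forall fun r => Eventually.of_forall fun ω =>
      norm_indicator_le_norm_self _ _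
  · filter_upwards [hX0] with ω hω
    refine tendsto_const_nhds.congr' ?_
    by_cases h : m ω ≤ s * X ω
    · filter_upwards [self_mem_nhdsWithin] with r hr
      have : s * X ω ≤ r * X ω := mul_le_mul_of_nonneg_right (le_of_lt hr) hω
      rw [Set.indicator_of_mem (by exact h), Set.indicator_of_mem (by exact h.trans this)]
    · have hc : Tendsto (fun r => r * X ω) (𝓝[>] s) (𝓝 (s * X ω)) :=
        ((continuous_mul_const (X ω)).tendsto s).mono_left nhdsWithin_le_nhds
      filter_upwards [hc.eventually_lt_const (not_le.1 h)] with r hr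
      rw [Set.indicator_of_notMem (by exact h), Set.indicator_of_notMem (by exact not_le.2 hr)]

lemma continuous_meanMax (hXi : Integrable X Q) (hmi : Integrable m Q) :
    Continuous (meanMax Q X m) := by
  have hi : ∀ r, Integrable (fun ω => max (r * X ω) (m ω)) Q := fun r => (hXi.const_mul r).sup hmi
  refine (LipschitzWith.of_dist_le_mul (K := (∫ ω, |X ω| ∂Q).toNNReal) fun r s => ?_).continuous
  rw [Real.coe_toNNReal _ (integral_nonneg fun ω => abs_nonneg _), Real.dist_eq, Real.dist_eq,
    meanMax, meanMax, ← integral_sub (hi r) (hi s), ← integral_mul_const]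
  refine (abs_integral_le_integral_abs).trans (integral_mono ((hi r).sub (hi s)).abs
    (hXi.abs.mul_const _) fun ω => ?_)
  refine (abs_max_sub_max_le_abs _ _ _).trans_eq ?_
  rw [← sub_mul, abs_mul, mul_comm]

lemma le_meanMax (hXi : Integrable X Q) (hmi : Integrable m Q) (hX1 : ∫ ω, X ω ∂Q = 1) (s : ℝ) :
    s ≤ meanMax Q X m s := by
  calc s = ∫ ω, s * X ω ∂Q := by rw [integral_const_mul, hX1, mul_one]
    _ ≤ _ := integral_mono (hXi.const_mul s) ((hXi.const_mul s).sup hmi) fun ω => le_max_left _ _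

lemma meanOn_nonneg (hX0 : ∀ᵐ ω ∂Q, 0 ≤ X ω) (s : ℝ) : 0 ≤ meanOn Q X m s := by
  refine integral_nonneg_of_ae ?_
  filter_upwards [hX0] with ω hω using Set.indicator_apply_nonneg fun _ => hω

lemma meanOn_le_one (hX : Measurable X) (hm : Measurable m) (hXi : Integrable X Q)
    (hX0 : ∀ᵐ ω ∂Q, 0 ≤ X ω) (hX1 : ∫ ω, X ω ∂Q = 1) (s : ℝ) : meanOn Q X m s ≤ 1 := by
  rw [← hX1]
  refine integral_mono_ae (hXi.indicator (measurableSet_le_const_mul hX hm s)) hXi ?_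
  filter_upwards [hX0] with ω hω using Set.indicator_apply_le' (fun _ => le_rfl) fun _ => hω

lemma monotone_meanOn (hX : Measurable X) (hm : Measurable m) (hXi : Integrable X Q)
    (hX0 : ∀ᵐ ω ∂Q, 0 ≤ X ω) : Monotone (meanOn Q X m) := by
  intro r s hrs
  refine integral_mono_ae (hXi.indicator (measurableSet_le_const_mul hX hm r))
    (hXi.indicator (measurableSet_le_const_mul hX hm s)) ?_
  filter_upwards [hX0] with ω hω
  refine Set.indicator_apply_le' (fun h => ?_) fun _ => Set.indicator_apply_nonneg fun _ => hω
  have h' : m ω ≤ s * X ω := le_trans h (mul_le_mul_of_nonneg_right hrs hω)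
  rw [Set.indicator_of_mem (by exact h')]

/-- The fundamental theorem of calculus on `(s, ∞)` for `exp (-meanMax)`; the boundary term at
infinity vanishes because `meanMax` dominates the identity. -/
lemma lintegral_Ioi_exp_neg_meanMax (hX : Measurable X) (hm : Measurable m) (hXi : Integrable X Q)
    (hmi : Integrable m Q) (hX0 : ∀ᵐ ω ∂Q, 0 ≤ X ω) (hX1 : ∫ ω, X ω ∂Q = 1) (s : ℝ) :
    ∫⁻ r in Set.Ioi s, ENNReal.ofReal (Real.exp (-meanMax Q X m r) * meanOn Q X m r) =
      ENNReal.ofReal (Real.exp (-meanMax Q X m s)) := by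
  have hcont : Continuous fun r => Real.exp (-meanMax Q X m r) :=
    Real.continuous_exp.comp (continuous_meanMax hXi hmi).neg
  have hmeas : Measurable fun r => Real.exp (-meanMax Q X m r) * meanOn Q X m r :=
    hcont.measurable.mul (monotone_meanOn hX hm hXi hX0).measurable
  have h0 : ∀ r, 0 ≤ Real.exp (-meanMax Q X m r) * meanOn Q X m r := fun r =>
    mul_nonneg (Real.exp_pos _).le (meanOn_nonneg hX0 r)
  have hint : IntegrableOn (fun r => Real.exp (-meanMax Q X m r) * meanOn Q X m r) (Set.Ioi s) := by
    refine (integrableOn_exp_neg_Ioi s).mono' hmeas.aestronglyMeasurable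
      (Eventually.of_forall fun r => ?_)
    rw [Real.norm_of_nonneg (h0 r)]
    refine (mul_le_of_le_one_right (Real.exp_pos _).le (meanOn_le_one hX hm hXi hX0 hX1 r)).trans ?_
    exact Real.exp_le_exp.2 (neg_le_neg (le_meanMax hXi hmi hX1 r))
  rw [← ofReal_integral_eq_lintegral_ofReal hint (Eventually.of_forall h0)]
  congr 1
  have hFTC : ∀ R, s ≤ R → ∫ r in s..R, Real.exp (-meanMax Q X m r) * meanOn Q X m r =
      Real.exp (-meanMax Q X m s) - Real.exp (-meanMax Q X m R) := by
    intro R hR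
    have hd : ∀ r, HasDerivWithinAt (fun r => -Real.exp (-meanMax Q X m r))
        (Real.exp (-meanMax Q X m r) * meanOn Q X m r) (Set.Ioi r) r := by
      intro r
      have := ((hasDerivWithinAt_meanMax hXi hmi hX0 r).fun_neg.exp).fun_neg
      rwa [mul_neg, neg_neg] at this
    rw [intervalIntegral.integral_eq_sub_of_hasDeriv_right hcont.fun_neg.continuousOn
      (fun r _ => hd r) ((intervalIntegrable_iff_integrableOn_Ioc_of_le hR).2
        (hint.mono_set Set.Ioc_subset_Ioi_self))]
    ring
  have hlim : Tendsto (fun R => Real.exp (-meanMax Q X m R)) atTop (𝓝 0) :=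
    Real.tendsto_exp_neg_atTop_nhds_zero.comp
      (tendsto_atTop_mono (le_meanMax hXi hmi hX1) tendsto_id)
  refine tendsto_nhds_unique (intervalIntegral_tendsto_integral_Ioi s hint tendsto_id) ?_
  have hsub := (tendsto_const_nhds (x := Real.exp (-meanMax Q X m s))).sub hlim
  rw [sub_zero] at hsub
  refine hsub.congr' ?_
  filter_upwards [eventually_ge_atTop s] with R hR using (hFTC R hR).symm

end Exponent

/-! ### Conditioning on the present -/

section Conditional

variable {Ω : Type*} {mΩ : MeasurableSpace Ω} {P : Measure Ω} [IsProbabilityMeasure P] {ξ : Ω → ℝ}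

omit [IsProbabilityMeasure P] in
lemma ae_pos_of_measure_mul_le_one
    (hlaw : ∀ s, 0 ≤ s → P {ω | s * ξ ω ≤ 1} = ENNReal.ofReal (Real.exp (-s))) :
    ∀ᵐ ω ∂P, 0 < ξ ω := by
  have hlim : Tendsto (fun s : ℝ => ENNReal.ofReal (Real.exp (-s))) atTop (𝓝 0) := by
    simpa [Function.comp_def] using
      (ENNReal.continuous_ofReal.tendsto 0).comp Real.tendsto_exp_neg_atTop_nhds_zero
  refine le_antisymm (ge_of_tendsto hlim ?_) zero_le
  filter_upwards [eventually_ge_atTop 0] with s hs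
  rw [← hlaw s hs]
  refine measure_mono fun ω hω => ?_
  have : ξ ω ≤ 0 := not_lt.1 hω
  exact (mul_nonpos_of_nonneg_of_nonpos hs this).trans zero_le_one

/-- A density of the law of `ξ⁻¹` on an event `A`, read off from its tails: as `ξ > 0`, the event
`s * ξ ≤ 1` is `s ≤ ξ⁻¹`. -/
lemma map_inv_restrict_eq_withDensity (hξ : Measurable ξ) (hpos : ∀ᵐ ω ∂P, 0 < ξ ω) {A : Set Ω}
    {f : ℝ → ℝ≥0∞}
    (hf : ∀ s, 0 ≤ s → ∫⁻ r in Set.Ioi s, f r = P (A ∩ {ω | s * ξ ω ≤ 1})) :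
    (P.restrict A).map (fun ω => (ξ ω)⁻¹) = (volume.restrict (Set.Ioi 0)).withDensity f := by
  have hinv : Measurable fun ω => (ξ ω)⁻¹ := hξ.inv
  refine Measure.ext_of_Ici _ _ fun s => ?_
  rw [Measure.map_apply hinv measurableSet_Ici, Measure.restrict_apply (hinv measurableSet_Ici),
    withDensity_apply _ measurableSet_Ici, Measure.restrict_restrict measurableSet_Ici]
  have h1 : (Set.Ici s ∩ Set.Ioi 0 : Set ℝ) =ᵐ[volume] Set.Ioi (max s 0) := by
    rw [← Set.Ioi_inter_Ioi]
    exact Ioi_ae_eq_Ici.symm.inter (ae_eq_refl _)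
  rw [Measure.restrict_congr_set h1, hf _ (le_max_right _ _), Set.inter_comm]
  refine measure_congr ?_
  filter_upwards [hpos] with ω hω
  refine propext (and_congr_right fun _ => ?_)
  change s ≤ (ξ ω)⁻¹ ↔ max s 0 * ξ ω ≤ 1
  rw [← le_div_iff₀ hω, one_div, max_le_iff, and_iff_left (inv_pos.2 hω).le]

lemma map_inv_eq_withDensity_exp (hξ : Measurable ξ)
    (hlaw : ∀ s, 0 ≤ s → P {ω | s * ξ ω ≤ 1} = ENNReal.ofReal (Real.exp (-s))) :
    P.map (fun ω => (ξ ω)⁻¹) =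
      (volume.restrict (Set.Ioi 0)).withDensity fun r => ENNReal.ofReal (Real.exp (-r)) := by
  have := map_inv_restrict_eq_withDensity hξ (ae_pos_of_measure_mul_le_one hlaw) (A := Set.univ)
    (f := fun r => ENNReal.ofReal (Real.exp (-r))) fun s hs => by
      rw [Set.univ_inter, hlaw s hs, ← ofReal_integral_eq_lintegral_ofReal
        (integrableOn_exp_neg_Ioi s) (Eventually.of_forall fun r => (Real.exp_pos _).le),
        integral_exp_neg_Ioi]
  rwa [Measure.restrict_univ] at this

/-- If `ξ⁻¹` is standard exponential and its law on the event `A` has density `exp (-r) * κ r`,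
then `κ ξ⁻¹` is the conditional probability of `A` given `ξ`. -/
lemma condExp_indicator_ae_eq (hξ : Measurable ξ)
    (hlaw : ∀ s, 0 ≤ s → P {ω | s * ξ ω ≤ 1} = ENNReal.ofReal (Real.exp (-s))) {A : Set Ω}
    (hA : MeasurableSet A) {κ : ℝ → ℝ} (hκ : Measurable κ) (hκ0 : ∀ r, 0 ≤ κ r)
    (hκA : ∀ s, 0 ≤ s → ∫⁻ r in Set.Ioi s, ENNReal.ofReal (Real.exp (-r) * κ r) =
      P (A ∩ {ω | s * ξ ω ≤ 1})) :
    P[A.indicator (fun _ => (1 : ℝ)) | MeasurableSpace.comap ξ inferInstance] =ᵐ[P]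
      fun ω => κ (ξ ω)⁻¹ := by
  have hpos := ae_pos_of_measure_mul_le_one hlaw
  have hdA := map_inv_restrict_eq_withDensity hξ hpos hκA
  have hd1 := map_inv_eq_withDensity_exp hξ hlaw
  have hle : MeasurableSpace.comap ξ inferInstance ≤ mΩ := hξ.comap_le
  have hinv : Measurable fun ω => (ξ ω)⁻¹ := hξ.inv
  -- the two sides agree on the events of `σ(ξ) = σ(ξ⁻¹)`
  have hset : ∀ C : Set ℝ, MeasurableSet C →
      ∫⁻ ω in ξ ⁻¹' C, ENNReal.ofReal (κ (ξ ω)⁻¹) ∂P = P (ξ ⁻¹' C ∩ A) := by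
    intro C hC
    have hC' : MeasurableSet (C⁻¹ : Set ℝ) := hC.inv
    have hpre : ξ ⁻¹' C = (fun ω => (ξ ω)⁻¹) ⁻¹' C⁻¹ := by ext ω; simp
    have hm2 : Measurable fun r => ENNReal.ofReal (κ r) := hκ.ennreal_ofReal
    rw [hpre, ← setLIntegral_map hC' hm2 hinv, hd1,
      ← Measure.restrict_apply (hinv hC'), ← Measure.map_apply hinv hC', hdA,
      withDensity_apply _ hC', setLIntegral_withDensity_eq_setLIntegral_mul _
        (by fun_prop) hm2 hC']
    refine lintegral_congr fun r => ?_
    rw [Pi.mul_apply, ENNReal.ofReal_mul (Real.exp_pos _).le]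
  have hκξ : Measurable fun ω => κ (ξ ω)⁻¹ := hκ.comp hξ.inv
  have hint : Integrable (fun ω => κ (ξ ω)⁻¹) P := by
    refine ⟨hκξ.aestronglyMeasurable, ?_⟩
    rw [hasFiniteIntegral_iff_ofReal (Eventually.of_forall fun ω => hκ0 _)]
    have := hset Set.univ .univ
    rw [Set.preimage_univ, Measure.restrict_univ] at this
    rw [this]; exact measure_lt_top _ _
  refine (ae_eq_condExp_of_forall_setIntegral_eq hle
    ((integrable_const _).indicator hA) (fun _ _ _ => hint.integrableOn) ?_ ?_).symm
  · rintro _ ⟨C, hC, rfl⟩ -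
    rw [integral_eq_lintegral_of_nonneg_ae (Eventually.of_forall fun ω => hκ0 _)
      hκξ.aestronglyMeasurable, hset C hC, integral_indicator hA,
      Measure.restrict_restrict hA, setIntegral_const, smul_eq_mul, mul_one, Set.inter_comm]
    rfl
  · exact (hκ.comp ((comap_measurable ξ).inv)).aestronglyMeasurable

end Conditional

section Markov

variable {Ω : Type*} {mΩ : MeasurableSpace Ω} {P : Measure Ω} [IsProbabilityMeasure P]
  {η : ℤ → Ω → ℝ}

/-- Past and future of a Markov process are conditionally independent given the present. -/
lemma IsMarkovProcess.condExp_indicator_inter (hMarkov : IsMarkovProcess P η)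
    (hη : ∀ t, Measurable (η t)) {t₁ t t₂ : ℤ} (h₁ : t₁ ≤ t) (h₂ : t ≤ t₂) {B₁ B₂ : Set ℝ}
    (hB₁ : MeasurableSet B₁) (hB₂ : MeasurableSet B₂) :
    P[(η t₁ ⁻¹' B₁ ∩ η t₂ ⁻¹' B₂).indicator (fun _ => (1 : ℝ)) |
        MeasurableSpace.comap (η t) inferInstance] =ᵐ[P]
      P[(η t₁ ⁻¹' B₁).indicator (fun _ => (1 : ℝ)) | MeasurableSpace.comap (η t) inferInstance] *
      P[(η t₂ ⁻¹' B₂).indicator (fun _ => (1 : ℝ)) |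
        MeasurableSpace.comap (η t) inferInstance] := by
  set past : MeasurableSpace Ω :=
    ⨆ r : {r : ℤ // r ≤ t}, MeasurableSpace.comap (η r) inferInstance with hpast
  set now : MeasurableSpace Ω := MeasurableSpace.comap (η t) inferInstance with hnow
  have hle : ∀ r : {r : ℤ // r ≤ t}, MeasurableSpace.comap (η r) inferInstance ≤ past := fun r =>
    le_iSup (fun r : {r : ℤ // r ≤ t} => MeasurableSpace.comap (η r) inferInstance) r
  have hpm : past ≤ mΩ := iSup_le fun r => (hη r).comap_le
  have hnp : now ≤ past := hle ⟨t, le_rfl⟩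
  set f := (η t₁ ⁻¹' B₁).indicator fun _ => (1 : ℝ) with hf
  set g := (η t₂ ⁻¹' B₂).indicator fun _ => (1 : ℝ) with hg
  have hfg : (η t₁ ⁻¹' B₁ ∩ η t₂ ⁻¹' B₂).indicator (fun _ => (1 : ℝ)) = f * g := by
    ext ω
    by_cases h1 : ω ∈ η t₁ ⁻¹' B₁ <;> by_cases h2 : ω ∈ η t₂ ⁻¹' B₂ <;> simp_all
  have hfi : Integrable f P := (integrable_const _).indicator (hη t₁ hB₁)
  have hgi : Integrable g P := (integrable_const _).indicator (hη t₂ hB₂)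
  have hfgi : Integrable (f * g) P := by
    rw [← hfg]; exact (integrable_const _).indicator ((hη t₁ hB₁).inter (hη t₂ hB₂))
  have hfpast : StronglyMeasurable[past] f :=
    stronglyMeasurable_const.indicator (hle ⟨t₁, h₁⟩ _ ⟨B₁, hB₁, rfl⟩)
  have hmark : P[g | past] =ᵐ[P] P[g | now] := hMarkov t t₂ h₂ B₂ hB₂
  have hstep : P[f * g | past] =ᵐ[P] f * P[g | now] :=
    (condExp_mul_of_stronglyMeasurable_left hfpast hfgi hgi).trans ((ae_eq_refl f).mul hmark)
  rw [hfg]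
  have hfgn : Integrable (f * P[g | now]) P :=
    (integrable_condExp (m := past) (f := f * g)).congr hstep
  calc P[f * g | now] =ᵐ[P] P[P[f * g | past] | now] := (condExp_condExp_of_le hnp hpm).symm
    _ =ᵐ[P] P[f * P[g | now] | now] := condExp_congr_ae hstep
    _ =ᵐ[P] P[f | now] * P[g | now] :=
      condExp_mul_of_stronglyMeasurable_right stronglyMeasurable_condExp hfgn hfi

end Markov

/-! ### Factorisation of the conditional probabilities -/

/-- The conditional probability, given that the max-stable process takes the value `1 / r` at a time
with spectral variable `X`, that its weighted values at some other times are at most `1`, where `m`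
is the maximum of the spectral variables at these times with the same weights. -/
noncomputable def condProb {Ω : Type*} [MeasurableSpace Ω] (Q : Measure Ω) (X m : Ω → ℝ)
    (r : ℝ) : ℝ :=
  Real.exp (r - meanMax Q X m r) * meanOn Q X m r

lemma eq_of_ae_eq_of_tendsto_right {f g : ℝ → ℝ} {s : ℝ} (hs : 0 ≤ s)
    (hf : Tendsto f (𝓝[>] s) (𝓝 (f s))) (hg : Tendsto g (𝓝[>] s) (𝓝 (g s)))
    (hfg : ∀ᵐ r ∂(volume.restrict (Set.Ioi 0)), f r = g r) : f s = g s := by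
  refine tendsto_nhds_unique_of_frequently_eq hf hg fun hne => ?_
  obtain ⟨b, hb, hsub⟩ := mem_nhdsGT_iff_exists_Ioo_subset.1 hne
  rw [ae_restrict_iff' measurableSet_Ioi] at hfg
  have h0 : volume (Set.Ioo s b) = 0 := by
    refine measure_mono_null (fun r hr => ?_) hfg
    exact fun h => hsub hr (h (hs.trans_lt hr.1))
  rw [Real.volume_Ioo, ENNReal.ofReal_eq_zero] at h0
  exact absurd hb (not_lt.2 (by simpa using h0))

lemma tendsto_condProb {Ω : Type*} [MeasurableSpace Ω] {Q : Measure Ω} {X m : Ω → ℝ}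
    (hX : Measurable X) (hm : Measurable m) (hXi : Integrable X Q) (hmi : Integrable m Q)
    (hX0 : ∀ᵐ ω ∂Q, 0 ≤ X ω) (s : ℝ) :
    Tendsto (condProb Q X m) (𝓝[>] s) (𝓝 (condProb Q X m s)) :=
  (((Real.continuous_exp.comp (continuous_id.sub (continuous_meanMax hXi hmi))).tendsto s).mono_left
    nhdsWithin_le_nhds).mul (tendsto_meanOn hX hm hXi hX0 s)

lemma measurable_condProb {Ω : Type*} [MeasurableSpace Ω] {Q : Measure Ω} {X m : Ω → ℝ}
    (hX : Measurable X) (hm : Measurable m) (hXi : Integrable X Q) (hmi : Integrable m Q)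
    (hX0 : ∀ᵐ ω ∂Q, 0 ≤ X ω) : Measurable (condProb Q X m) :=
  (Real.continuous_exp.comp (continuous_id.sub (continuous_meanMax hXi hmi))).measurable.mul
    (monotone_meanOn hX hm hXi hX0).measurable

/-- `condProb` is a version of the conditional probability of an event `A` which has, jointly with
`ξ`, the distribution function with exponent `meanMax Q X m`. -/
lemma condExp_indicator_ae_eq_condProb {Ω Ω' : Type*} [MeasurableSpace Ω] [MeasurableSpace Ω']
    {P : Measure Ω} [IsProbabilityMeasure P] {ξ : Ω → ℝ} (hξ : Measurable ξ)
    (hlaw : ∀ s, 0 ≤ s → P {ω | s * ξ ω ≤ 1} = ENNReal.ofReal (Real.exp (-s)))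
    {Q : Measure Ω'} {X m : Ω' → ℝ}
    (hX : Measurable X) (hm : Measurable m) (hXi : Integrable X Q) (hmi : Integrable m Q)
    (hX0 : ∀ᵐ ω ∂Q, 0 ≤ X ω) (hX1 : ∫ ω, X ω ∂Q = 1) {A : Set Ω} (hA : MeasurableSet A)
    (hPA : ∀ s, 0 ≤ s → P (A ∩ {ω | s * ξ ω ≤ 1}) =
      ENNReal.ofReal (Real.exp (-meanMax Q X m s))) :
    P[A.indicator (fun _ => (1 : ℝ)) | MeasurableSpace.comap ξ inferInstance] =ᵐ[P]
      fun ω => condProb Q X m (ξ ω)⁻¹ := by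
  refine condExp_indicator_ae_eq hξ hlaw hA (measurable_condProb hX hm hXi hmi hX0)
    (fun r => mul_nonneg (Real.exp_pos _).le (meanOn_nonneg hX0 r)) fun s hs => ?_
  rw [hPA s hs, ← lintegral_Ioi_exp_neg_meanMax hX hm hXi hmi hX0 hX1 s]
  refine lintegral_congr fun r => ?_
  rw [condProb, ← mul_assoc, ← Real.exp_add]
  congr 3
  ring

section Spectral

variable {Ω Ω' Ω'' : Type*} [MeasurableSpace Ω] [MeasurableSpace Ω'] [MeasurableSpace Ω'']
  {P : Measure Ω} [IsProbabilityMeasure P] {Q : Measure Ω'} [IsProbabilityMeasure Q]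
  {ρ : Measure Ω''} [IsProbabilityMeasure ρ] {η : ℤ → Ω → ℝ} {Y : ℤ → Ω' → ℝ} {U : ℕ → Ω'' → ℝ}
  {Yc : ℕ → ℤ → Ω'' → ℝ}

/-- The conditional independence of `η t₁` and `η t₂` given `η t`, in terms of the spectral
process. -/
theorem IsSpectralRepresentation.condProb_max_eq_mul
    (hY : IsSpectralRepresentation P η Q Y ρ U Yc) (hη : ∀ t, Measurable (η t))
    (hMarkov : IsMarkovProcess P η) {t₁ t t₂ : ℤ} (ht₁ : t₁ ≤ t) (ht₂ : t ≤ t₂) {a₁ a₂ : ℝ}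
    (h₁ : 0 ≤ a₁) (h₂ : 0 ≤ a₂) {r : ℝ} (hr : 0 ≤ r) :
    condProb Q (Y t) (fun ω => max (a₁ * Y t₁ ω) (a₂ * Y t₂ ω)) r =
      condProb Q (Y t) (fun ω => a₁ * Y t₁ ω) r * condProb Q (Y t) (fun ω => a₂ * Y t₂ ω) r := by
  have hB : ∀ a : ℝ, MeasurableSet {x : ℝ | a * x ≤ 1} := fun a =>
    measurableSet_le (measurable_const.mul measurable_id) measurable_const
  have hA₁ := hη t₁ (hB a₁)
  have hA₂ := hη t₂ (hB a₂)
  have hX := hY.measurable t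
  have hXi := hY.integrable t
  have hX0 := hY.nonneg t
  have hX1 := hY.integral_eq_one t
  have hm₁ : Measurable fun ω => a₁ * Y t₁ ω := (hY.measurable t₁).const_mul a₁
  have hm₂ : Measurable fun ω => a₂ * Y t₂ ω := (hY.measurable t₂).const_mul a₂
  have hi₁ := (hY.integrable t₁).const_mul a₁
  have hi₂ := (hY.integrable t₂).const_mul a₂
  have hlaw : ∀ s, 0 ≤ s → P {ω | s * η t ω ≤ 1} = ENNReal.ofReal (Real.exp (-s)) := by
    intro s hs
    have := hY.measure_mul_le_one t₁ t t₂ le_rfl hs le_rfl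
    simp only [zero_mul, zero_le_one, true_and, and_true] at this
    rw [this]
    congr 3
    calc _ = ∫ ω, s * Y t ω ∂Q := by
          refine integral_congr_ae ?_
          filter_upwards [hX0] with ω hω
          have := mul_nonneg hs hω
          rw [max_eq_left this, max_eq_right this]
      _ = s := by rw [integral_const_mul, hX1, mul_one]
  have hP₁₂ : ∀ s, 0 ≤ s → P ((η t₁ ⁻¹' {x | a₁ * x ≤ 1} ∩ η t₂ ⁻¹' {x | a₂ * x ≤ 1}) ∩
      {ω | s * η t ω ≤ 1}) = ENNReal.ofReal (Real.exp
        (-meanMax Q (Y t) (fun ω => max (a₁ * Y t₁ ω) (a₂ * Y t₂ ω)) s)) := by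
    intro s hs
    simp only [meanMax, max_left_comm (s * _)]
    rw [← hY.measure_mul_le_one t₁ t t₂ h₁ hs h₂]
    congr 1
    ext ω
    simp only [Set.mem_inter_iff, Set.mem_preimage, Set.mem_ofPred_eq]
    tauto
  have hP₁ : ∀ s, 0 ≤ s → P (η t₁ ⁻¹' {x | a₁ * x ≤ 1} ∩ {ω | s * η t ω ≤ 1}) =
      ENNReal.ofReal (Real.exp (-meanMax Q (Y t) (fun ω => a₁ * Y t₁ ω) s)) := by
    intro s hs
    have := hY.measure_mul_le_one t₁ t t₂ h₁ hs le_rfl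
    simp only [zero_mul, zero_le_one, and_true] at this
    refine this.trans ?_
    congr 3
    refine integral_congr_ae ?_
    filter_upwards [hX0] with ω hω
    rw [max_eq_left (mul_nonneg hs hω), max_comm]
  have hP₂ : ∀ s, 0 ≤ s → P (η t₂ ⁻¹' {x | a₂ * x ≤ 1} ∩ {ω | s * η t ω ≤ 1}) =
      ENNReal.ofReal (Real.exp (-meanMax Q (Y t) (fun ω => a₂ * Y t₂ ω) s)) := by
    intro s hs
    have := hY.measure_mul_le_one t₁ t t₂ le_rfl hs h₂
    simp only [zero_mul, zero_le_one, true_and] at this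
    rw [Set.inter_comm]
    refine this.trans ?_
    congr 3
    refine integral_congr_ae ?_
    filter_upwards [hX0] with ω hω
    exact max_eq_right (le_max_of_le_left (mul_nonneg hs hω))
  have e₁₂ := condExp_indicator_ae_eq_condProb (hη t) hlaw hX (hm₁.max hm₂) hXi (hi₁.sup hi₂)
    hX0 hX1 (hA₁.inter hA₂) hP₁₂
  have e₁ := condExp_indicator_ae_eq_condProb (hη t) hlaw hX hm₁ hXi hi₁ hX0 hX1 hA₁ hP₁
  have e₂ := condExp_indicator_ae_eq_condProb (hη t) hlaw hX hm₂ hXi hi₂ hX0 hX1 hA₂ hP₂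
  have hae : ∀ᵐ ω ∂P, condProb Q (Y t) (fun ω => max (a₁ * Y t₁ ω) (a₂ * Y t₂ ω)) (η t ω)⁻¹ =
      condProb Q (Y t) (fun ω => a₁ * Y t₁ ω) (η t ω)⁻¹ *
        condProb Q (Y t) (fun ω => a₂ * Y t₂ ω) (η t ω)⁻¹ := by
    filter_upwards [e₁₂, e₁, e₂, hMarkov.condExp_indicator_inter hη ht₁ ht₂ (hB a₁) (hB a₂)]
      with ω w₁₂ w₁ w₂ w
    rw [← w₁₂, ← w₁, ← w₂, w, Pi.mul_apply]
  have hc₁₂ := measurable_condProb hX (hm₁.max hm₂) hXi (hi₁.sup hi₂) hX0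
  have hc := (measurable_condProb hX hm₁ hXi hi₁ hX0).mul (measurable_condProb hX hm₂ hXi hi₂ hX0)
  have hae' := (ae_map_iff (hη t).inv.aemeasurable (measurableSet_eq_fun hc₁₂ hc)).2 hae
  have hlaw' := map_inv_eq_withDensity_exp (hη t) hlaw
  rw [show (η t)⁻¹ = fun ω => (η t ω)⁻¹ from rfl, hlaw', ae_withDensity_iff (by fun_prop)] at hae'
  refine eq_of_ae_eq_of_tendsto_right hr (tendsto_condProb hX (hm₁.max hm₂) hXi (hi₁.sup hi₂) hX0 r)
    ((tendsto_condProb hX hm₁ hXi hi₁ hX0 r).mul (tendsto_condProb hX hm₂ hXi hi₂ hX0 r)) ?_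
  filter_upwards [hae'] with r hr
  exact hr (by simp [Real.exp_pos])

end Spectral

/-! ### Ratios to the present value and their essential infima -/

section Ratio

variable {Ω : Type*} [MeasurableSpace Ω] {Q : Measure Ω} {X m m₁ m₂ : Ω → ℝ}

/-- Scaling `m` with `r` makes the event in `condProb` independent of `r` and the exponent linear
in `r`. -/
lemma condProb_const_mul {r : ℝ} (hr : 0 < r) :
    condProb Q X (fun ω => r * m ω) r =
      Real.exp (r * (1 - meanMax Q X m 1)) * meanOn Q X m 1 := by
  have h1 : meanMax Q X (fun ω => r * m ω) r = r * meanMax Q X m 1 := by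
    rw [meanMax, meanMax, ← integral_const_mul]
    refine integral_congr_ae (Eventually.of_forall fun ω => ?_)
    simp only [one_mul, mul_max_of_nonneg _ _ hr.le]
  have h2 : meanOn Q X (fun ω => r * m ω) r = meanOn Q X m 1 := by
    simp only [meanOn, mul_le_mul_iff_right₀ hr, one_mul]
  rw [condProb, h1, h2]
  congr 2; ring

/-- The exponents in the factorisation are linear in `r`, so they have to agree, and this forces
`m₁ > X` and `m₂ > X` to be incompatible events. Being also independent under the probability
measure with density `X`, one of them is null. -/
lemma meanOn_eq_zero_or_eq_one (hX : Measurable X) (hm₁ : Measurable m₁) (hm₂ : Measurable m₂)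
    (hXi : Integrable X Q) (hi₁ : Integrable m₁ Q) (hi₂ : Integrable m₂ Q)
    (hX1 : ∫ ω, X ω ∂Q = 1)
    (hmul : ∀ r, 0 < r → condProb Q X (fun ω => max (r * m₁ ω) (r * m₂ ω)) r =
      condProb Q X (fun ω => r * m₁ ω) r * condProb Q X (fun ω => r * m₂ ω) r) :
    (meanOn Q X m₁ 1 = 0 ∨ meanOn Q X m₁ 1 = 1) ∨
      (meanOn Q X m₂ 1 = 0 ∨ meanOn Q X m₂ 1 = 1) := by
  set V := meanMax Q X (fun ω => max (m₁ ω) (m₂ ω)) 1 with hV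
  set V₁ := meanMax Q X m₁ 1 with hV₁
  set V₂ := meanMax Q X m₂ 1 with hV₂
  set q := meanOn Q X (fun ω => max (m₁ ω) (m₂ ω)) 1 with hq
  set q₁ := meanOn Q X m₁ 1 with hq₁
  set q₂ := meanOn Q X m₂ 1 with hq₂
  have hexp : ∀ r, 0 < r → Real.exp (r * (1 - V)) * q =
      Real.exp (r * (1 - V₁)) * Real.exp (r * (1 - V₂)) * (q₁ * q₂) := by
    intro r hr
    have h := hmul r hr
    simp only [← mul_max_of_nonneg _ _ hr.le] at h
    rw [condProb_const_mul (m := fun ω => max (m₁ ω) (m₂ ω)) hr, condProb_const_mul (m := m₁) hr,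
      condProb_const_mul (m := m₂) hr] at h
    rw [h]; ring
  by_cases hq0 : q₁ * q₂ = 0
  · rcases mul_eq_zero.1 hq0 with h | h
    · exact Or.inl (Or.inl h)
    · exact Or.inr (Or.inl h)
  -- compare the factorisations at `r = 1` and `r = 2`
  have hV12 : V + 1 = V₁ + V₂ := by
    have e1 := hexp 1 one_pos
    have e2 := hexp 2 two_pos
    simp only [two_mul, Real.exp_add, one_mul] at e1 e2
    have hx := Real.exp_pos (1 - V)
    have hy := mul_pos (Real.exp_pos (1 - V₁)) (Real.exp_pos (1 - V₂))
    have e3 : Real.exp (1 - V) = Real.exp (1 - V₁) * Real.exp (1 - V₂) := by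
      have : (Real.exp (1 - V₁) * Real.exp (1 - V₂) * (q₁ * q₂)) * Real.exp (1 - V) =
          (Real.exp (1 - V₁) * Real.exp (1 - V₂) * (q₁ * q₂)) *
            (Real.exp (1 - V₁) * Real.exp (1 - V₂)) := by
        rw [← e1]
        linear_combination e2 - Real.exp (1 - V₁) * Real.exp (1 - V₂) * e1
      exact mul_left_cancel₀ (mul_ne_zero hy.ne' hq0) this
    rw [← Real.exp_add] at e3
    have := Real.exp_injective e3
    linarith
  have hqq : q = q₁ * q₂ := by
    have e1 := hexp 1 one_pos
    rw [← Real.exp_add, show 1 * (1 - V₁) + 1 * (1 - V₂) = 1 * (1 - V) by linarith] at e1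
    exact mul_left_cancel₀ (Real.exp_pos _).ne' e1
  -- the overlap of the excesses of `m₁` and `m₂` over `X` has mean zero
  have hdisj : ∀ᵐ ω ∂Q, m₁ ω ≤ X ω ∨ m₂ ω ≤ X ω := by
    have hI₁ : Integrable (fun ω => max (1 * X ω) (m₁ ω)) Q := (hXi.const_mul 1).sup hi₁
    have hI₂ : Integrable (fun ω => max (1 * X ω) (m₂ ω)) Q := (hXi.const_mul 1).sup hi₂
    have hI : Integrable (fun ω => max (1 * X ω) (max (m₁ ω) (m₂ ω))) Q :=
      (hXi.const_mul 1).sup (hi₁.sup hi₂)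
    have hint := ((hI₁.add hI₂).sub hI).sub hXi
    have h0 : ∫ ω, (((fun ω => max (1 * X ω) (m₁ ω)) + fun ω => max (1 * X ω) (m₂ ω)) -
        (fun ω => max (1 * X ω) (max (m₁ ω) (m₂ ω))) - X) ω ∂Q = 0 := by
      rw [integral_sub' ((hI₁.add hI₂).sub hI) hXi, integral_sub' (hI₁.add hI₂) hI,
        integral_add' hI₁ hI₂, hX1]
      change V₁ + V₂ - V - 1 = 0
      linarith
    rw [integral_eq_zero_iff_of_nonneg _ hint] at h0
    · filter_upwards [h0] with ω hω
      by_contra! h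
      simp only [Pi.sub_apply, Pi.add_apply, Pi.zero_apply, one_mul] at hω
      rw [max_eq_right h.1.le, max_eq_right h.2.le,
        max_eq_right (h.1.le.trans (le_max_left _ _))] at hω
      rcases le_total (m₁ ω) (m₂ ω) with hle | hle
      · rw [max_eq_right hle] at hω; linarith [h.1]
      · rw [max_eq_left hle] at hω; linarith [h.2]
    · intro ω
      simp only [Pi.sub_apply, Pi.add_apply, Pi.zero_apply, one_mul]
      have a1 := le_max_left (X ω) (m₁ ω)
      have a2 := le_max_left (X ω) (m₂ ω)
      have b1 := le_max_right (X ω) (m₁ ω)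
      have b2 := le_max_right (X ω) (m₂ ω)
      have : max (X ω) (max (m₁ ω) (m₂ ω)) ≤ max (X ω) (m₁ ω) + max (X ω) (m₂ ω) - X ω :=
        max_le (by linarith) (max_le (by linarith) (by linarith))
      linarith
  -- inclusion-exclusion for two events whose complements are disjoint
  have hadd : q + 1 = q₁ + q₂ := by
    have hI := fun (m : Ω → ℝ) (hm : Measurable m) =>
      hXi.indicator (measurableSet_le_const_mul hX hm 1)
    rw [← hX1, hq, hq₁, hq₂, meanOn, meanOn, meanOn, ← integral_add (hI _ (hm₁.max hm₂)) hXi,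
      ← integral_add (hI _ hm₁) (hI _ hm₂)]
    refine integral_congr_ae ?_
    filter_upwards [hdisj] with ω hω
    simp only [Set.indicator_apply, Set.mem_ofPred_eq, one_mul, max_le_iff]
    rcases hω with h | h
    · by_cases h' : m₂ ω ≤ X ω <;> simp [h, h']
    · by_cases h' : m₁ ω ≤ X ω <;> simp [h, h']
  have hfac : (q₁ - 1) * (q₂ - 1) = 0 := by linear_combination hadd - hqq
  rcases mul_eq_zero.1 hfac with h | h
  · exact Or.inl (Or.inr (by linarith))
  · exact Or.inr (Or.inr (by linarith))

lemma ae_cond_iff [IsFiniteMeasure Q] {s : Set Ω} (hs : MeasurableSet s) {p : Ω → Prop} :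
    (∀ᵐ ω ∂cond Q s, p ω) ↔ ∀ᵐ ω ∂Q, ω ∈ s → p ω := by
  rw [ProbabilityTheory.cond, Measure.ae_ennreal_smul_measure_iff
    (ENNReal.inv_ne_zero.2 (measure_ne_top _ _)), ae_restrict_iff' hs]

/-- A nonnegative random variable which is not a.s. equal to its essential infimum exceeds some
level `c > 0` with probability strictly between `0` and `1`. -/
lemma exists_level_of_not_ae_eq_sInf {μ : Measure Ω} [IsProbabilityMeasure μ] {R : Ω → ℝ}
    (hR0 : ∀ᵐ ω ∂μ, 0 ≤ R ω)
    (hR : ¬ ∀ᵐ ω ∂μ, R ω = sInf {c : ℝ | 0 < c ∧ 0 < μ {ω | R ω ≤ c}}) :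
    ∃ c, 0 < c ∧ (¬ ∀ᵐ ω ∂μ, c < R ω) ∧ ¬ ∀ᵐ ω ∂μ, R ω ≤ c := by
  by_contra hex
  have hcon : ∀ c, 0 < c → (¬ ∀ᵐ ω ∂μ, c < R ω) → ∀ᵐ ω ∂μ, R ω ≤ c := fun c hc h1 =>
    not_not.1 fun h2 => hex ⟨c, hc, h1, h2⟩
  set S := {c : ℝ | 0 < c ∧ 0 < μ {ω | R ω ≤ c}} with hS
  have hnull : ∀ c, (∀ᵐ ω ∂μ, c < R ω) ↔ ¬ 0 < μ {ω | R ω ≤ c} := by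
    intro c
    rw [not_lt, nonpos_iff_eq_zero, ae_iff]
    simp only [not_lt]
  have hbdd : BddBelow S := ⟨0, fun c hc => hc.1.le⟩
  have hne : S.Nonempty := by
    by_contra hemp
    -- otherwise `R` exceeds every natural number
    have : ∀ n : ℕ, ∀ᵐ ω ∂μ, ((n + 1 : ℕ) : ℝ) < R ω := fun n => (hnull _).2 fun h =>
      hemp ⟨_, by positivity, h⟩
    obtain ⟨ω, hω⟩ := (ae_all_iff.2 this).exists
    obtain ⟨n, hn⟩ := exists_nat_gt (R ω)
    have := hω n
    push_cast at this
    linarith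
  have hle : ∀ᵐ ω ∂μ, R ω ≤ sInf S := by
    have : ∀ n : ℕ, ∀ᵐ ω ∂μ, R ω ≤ sInf S + 1 / ((n : ℝ) + 1) := by
      intro n
      obtain ⟨c, hc, hlt⟩ := exists_lt_of_csInf_lt hne
        (lt_add_of_pos_right (sInf S) (Nat.one_div_pos_of_nat (n := n)))
      filter_upwards [hcon c hc.1 fun h => (hnull c).1 h hc.2] with ω hω using hω.trans hlt.le
    filter_upwards [ae_all_iff.2 this] with ω hω
    refine le_of_forall_pos_le_add fun ε hε => ?_
    obtain ⟨n, hn⟩ := exists_nat_one_div_lt hε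
    exact (hω n).trans (by linarith)
  have hge : ∀ᵐ ω ∂μ, sInf S ≤ R ω := by
    have : ∀ n : ℕ, ∀ᵐ ω ∂μ, sInf S - 1 / ((n : ℝ) + 1) ≤ R ω := by
      intro n
      have hpos : (0 : ℝ) < 1 / ((n : ℝ) + 1) := Nat.one_div_pos_of_nat
      rcases le_or_gt (sInf S - 1 / ((n : ℝ) + 1)) 0 with h | h
      · filter_upwards [hR0] with ω hω using h.trans hω
      · have := (hnull (sInf S - 1 / ((n : ℝ) + 1))).2 fun h' =>
          absurd (csInf_le hbdd (show _ ∈ S from ⟨h, h'⟩)) (by linarith)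
        filter_upwards [this] with ω hω using hω.le
    filter_upwards [ae_all_iff.2 this] with ω hω
    refine le_of_forall_pos_le_add fun ε hε => ?_
    obtain ⟨n, hn⟩ := exists_nat_one_div_lt hε
    linarith [hω n]
  exact hR (by filter_upwards [hle, hge] with ω h1 h2 using le_antisymm h1 h2)

/-- If `Y t' / Y t` is not a.s. equal to its essential infimum given `Y t > 0`, then for some `b`
the event `b * Y t' ≤ Y t` has probability strictly between `0` and `1` under the measure with
density `Y t`. -/
lemma exists_meanOn_ne {Y : ℤ → Ω → ℝ} [IsProbabilityMeasure Q] (hYm : ∀ t, Measurable (Y t))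
    (hY0 : ∀ t, ∀ᵐ ω ∂Q, 0 ≤ Y t ω) (hY1 : ∀ t, ∫ ω, Y t ω ∂Q = 1)
    (hYi : ∀ t, Integrable (Y t) Q) (t t' : ℤ)
    (hne : cond Q {ω | 0 < Y t ω} {ω | Y t' ω = ratioEssInf Q Y t t' * Y t ω} ≠ 1) :
    ∃ b, 0 ≤ b ∧ meanOn Q (Y t) (fun ω => b * Y t' ω) 1 ≠ 0 ∧
      meanOn Q (Y t) (fun ω => b * Y t' ω) 1 ≠ 1 := by
  have hD : MeasurableSet {ω | 0 < Y t ω} := measurableSet_lt measurable_const (hYm t)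
  have hQD : Q {ω | 0 < Y t ω} ≠ 0 := by
    intro h
    have h' : ∀ᵐ ω ∂Q, Y t ω ≤ 0 := by
      rw [ae_iff]; simpa only [not_le] using h
    have := integral_nonpos_of_ae (μ := Q) h'
    rw [hY1 t] at this
    linarith
  have : IsProbabilityMeasure (cond Q {ω | 0 < Y t ω}) := cond_isProbabilityMeasure hQD
  have hiff := fun p : Ω → Prop => ae_cond_iff (Q := Q) hD (p := p)
  obtain ⟨c, hc, hc1, hc2⟩ := exists_level_of_not_ae_eq_sInf (μ := cond Q {ω | 0 < Y t ω})
    (R := fun ω => Y t' ω / Y t ω)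
    ((hiff _).2 (by
      filter_upwards [hY0 t'] with ω hω hpos using div_nonneg hω (le_of_lt hpos)))
    (by
      intro h
      refine hne ?_
      have hE : MeasurableSet {ω | Y t' ω = ratioEssInf Q Y t t' * Y t ω} :=
        measurableSet_eq_fun (hYm t') ((hYm t).const_mul _)
      rw [← prob_compl_eq_zero_iff hE]
      change ∀ᵐ ω ∂cond Q {ω | 0 < Y t ω}, Y t' ω = ratioEssInf Q Y t t' * Y t ω
      rw [hiff] at h ⊢
      filter_upwards [h] with ω hω hpos
      exact (div_eq_iff (ne_of_gt hpos)).1 (hω hpos))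
  rw [hiff] at hc1 hc2
  have hm : Measurable fun ω => c⁻¹ * Y t' ω := (hYm t').const_mul _
  have hI := (hYi t).indicator (measurableSet_le_const_mul (hYm t) hm 1)
  refine ⟨c⁻¹, (inv_pos.2 hc).le, fun h0 => hc1 ?_, fun h1 => hc2 ?_⟩
  · rw [meanOn, integral_eq_zero_iff_of_nonneg_ae _ hI] at h0
    · filter_upwards [h0] with ω hω hpos
      have hpos : 0 < Y t ω := hpos
      by_contra hle
      rw [not_lt, div_le_iff₀ hpos] at hle
      rw [Set.indicator_of_mem] at hω
      · exact hpos.ne' hω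
      · change c⁻¹ * Y t' ω ≤ 1 * Y t ω
        rwa [one_mul, inv_mul_le_iff₀ hc]
    · filter_upwards [hY0 t] with ω hω using Set.indicator_apply_nonneg fun _ => hω
  · have h2 : ∫ ω, (Y t - {ω | c⁻¹ * Y t' ω ≤ 1 * Y t ω}.indicator (Y t)) ω ∂Q = 0 := by
      rw [integral_sub' (hYi t) hI, hY1 t, sub_eq_zero]; exact h1.symm
    rw [integral_eq_zero_iff_of_nonneg_ae _ ((hYi t).sub hI)] at h2
    · filter_upwards [h2] with ω hω hpos
      have hpos : 0 < Y t ω := hpos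
      by_contra hle
      rw [div_le_iff₀ hpos] at hle
      rw [Pi.sub_apply, Set.indicator_of_notMem, sub_zero] at hω
      · exact hpos.ne' hω
      · change ¬ c⁻¹ * Y t' ω ≤ 1 * Y t ω
        rwa [one_mul, inv_mul_le_iff₀ hc]
    · filter_upwards [hY0 t] with ω hω
      rw [Pi.sub_apply, Pi.zero_apply, sub_nonneg]
      exact Set.indicator_apply_le' (fun _ => le_rfl) fun _ => hω

end Ratio

theorem proposition3p1 {Ω Ω' Ω'' : Type*} [MeasurableSpace Ω] [MeasurableSpace Ω']
    [MeasurableSpace Ω''] (P : Measure Ω) [IsProbabilityMeasure P]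
    (Q : Measure Ω') [IsProbabilityMeasure Q] (ρ : Measure Ω'') [IsProbabilityMeasure ρ]
    (η : ℤ → Ω → ℝ) (Y : ℤ → Ω' → ℝ) (U : ℕ → Ω'' → ℝ) (Yc : ℕ → ℤ → Ω'' → ℝ)
    (hη : IsSimpleMaxStable P η) (hY : IsSpectralRepresentation P η Q Y ρ U Yc)
    (hMarkov : IsMarkovProcess P η) :
    ∀ t₁ t t₂ : ℤ, t₁ < t → t < t₂ →
      cond Q {ω | 0 < Y t ω} {ω | Y t₁ ω = ratioEssInf Q Y t t₁ * Y t ω} = 1 ∨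
      cond Q {ω | 0 < Y t ω} {ω | Y t₂ ω = ratioEssInf Q Y t t₂ * Y t ω} = 1 := by
  intro t₁ t t₂ h₁ h₂
  by_contra! hcon
  obtain ⟨b₁, hb₁, h10, h11⟩ := exists_meanOn_ne hY.measurable hY.nonneg hY.integral_eq_one
    hY.integrable t t₁ hcon.1
  obtain ⟨b₂, hb₂, h20, h21⟩ := exists_meanOn_ne hY.measurable hY.nonneg hY.integral_eq_one
    hY.integrable t t₂ hcon.2
  have key := meanOn_eq_zero_or_eq_one (hY.measurable t) ((hY.measurable t₁).const_mul b₁)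
    ((hY.measurable t₂).const_mul b₂) (hY.integrable t) ((hY.integrable t₁).const_mul b₁)
    ((hY.integrable t₂).const_mul b₂) (hY.integral_eq_one t) fun r hr => by
      simpa only [mul_assoc] using hY.condProb_max_eq_mul hη.measurable hMarkov h₁.le h₂.le
        (mul_nonneg hr.le hb₁) (mul_nonneg hr.le hb₂) hr.le
  tauto
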